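/- Let $n,t\in\mathbb N$, let $G$ be an infinite (commutative, unital) integral domain, and let $P\colon G^n\to G^t$ be a polynomial mapping over $G$, that is, $P=(p_1,\dots,p_t)$ where each $p_i\colon G^n\to G$ is given by a polynomial in $n$ variables with coefficients in $G$. Suppose that $P(0)=0$, and let $F\subset G^n$ be a finite set such that $P$ is one-to-one on $F$. Then for every $r\in\mathbb N$ and every coloring $\chi\colon G^t\to\{1,\dots,r\}$ there are $h\in G^t$ and $x\in G$ such that the set $$h+P(xF)=\{\,h+P(xv) : v\in F\,\}$$ is monochromatic (that is, $\chi$ takes a single value on it) and has the same cardinality as $F$. Here $xv=(xv_1,\dots,xv_n)$ for $v=(v_1,\dots,v_n)\in G^n$, and the empty set counts as monochromatic. -/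

import Mathlib

/-- A map `P : Gⁿ → Gᵗ` is a polynomial mapping over the commutative ring `G` if each of its `t`
components is the evaluation of a polynomial in `n` variables with coefficients in `G`. -/
def IsPolynomialMapping {G : Type*} [CommRing G] {n t : ℕ}
    (P : (Fin n → G) → (Fin t → G)) : Prop :=
  ∃ p : Fin t → MvPolynomial (Fin n) G, ∀ v i, P v i = MvPolynomial.eval v (p i)

/-- A set `A` is monochromatic for the `r`-coloring `χ` if `χ` takes a single value on `A`. -/
def IsMonochromatic {W : Type*} {r : ℕ} (χ : W → Fin r) (A : Set W) : Prop :=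
  ∃ c : Fin r, ∀ a ∈ A, χ a = c

/-! The set `h + P(xF)` is found by applying the polynomial van der Waerden theorem to the maps
`x ↦ P(xv) - P(0)`, `v ∈ F`. That theorem is proved for maps between abelian groups annihilated
by sufficiently many differences, by Bergelson and Leibman's PET induction: for a map `p` of least
degree in a finite family, the maps `x ↦ q(x + y) - q(y) - p(x)` form a simpler family, and color
focusing lifts recurrence from the simpler families to the given one. The step `x` can be chosen
outside any finite set, hence outside the finitely many roots of the nonzero polynomials among the
coordinates of `P(xv) - P(xw)`, so that `x ↦ P(xv)` still separates the points of `F`. -/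

open fwdDiff Pointwise

section DifferenceDegree

variable {S M : Type*} [AddCommGroup S] [AddCommGroup M]

variable (S M) in
/-- The maps `S → M` of degree less than `d`, in the sense that all their `d`-fold differences
vanish; these are Leibman's polynomial maps between abelian groups. -/
def differenceDegreeLT : ℕ → Submodule ℤ (S → M)
  | 0 => ⊥
  | d + 1 => ⨅ y, (differenceDegreeLT d).comap (fwdDiff_aux.fwdDiffₗ S M y)

theorem mem_differenceDegreeLT_succ {d : ℕ} {f : S → M} :
    f ∈ differenceDegreeLT S M (d + 1) ↔ ∀ y, Δ_[y] f ∈ differenceDegreeLT S M d := by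
  simp only [differenceDegreeLT, Submodule.mem_iInf, Submodule.mem_comap]
  rfl

theorem differenceDegreeLT_mono : Monotone (differenceDegreeLT S M) := by
  refine monotone_nat_of_le_succ fun d => ?_
  induction d with
  | zero => exact bot_le
  | succ d ih =>
    exact fun f hf => mem_differenceDegreeLT_succ.2 fun y => ih (mem_differenceDegreeLT_succ.1 hf y)

theorem const_mem_differenceDegreeLT (d : ℕ) (m : M) :
    (fun _ => m) ∈ differenceDegreeLT S M (d + 1) :=
  mem_differenceDegreeLT_succ.2 fun y => by
    rw [fwdDiff_const]
    exact zero_mem _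

theorem sub_const_mem_differenceDegreeLT {d : ℕ} {f : S → M} (hf : f ∈ differenceDegreeLT S M d)
    (s : S) : (fun x => f x - f s) ∈ differenceDegreeLT S M d := by
  cases d with
  | zero =>
    obtain rfl : f = 0 := hf
    exact funext fun _ => sub_zero 0
  | succ d => exact sub_mem hf (const_mem_differenceDegreeLT d (f s))

theorem mem_differenceDegreeLT_pi {ι R : Type*} [AddCommGroup R] {d : ℕ} {f : S → ι → R}
    (hf : ∀ i, (fun x => f x i) ∈ differenceDegreeLT S R d) :
    f ∈ differenceDegreeLT S (ι → R) d := by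
  induction d generalizing f with
  | zero => exact funext fun x => funext fun i => congrFun (hf i) x
  | succ d ih =>
    exact mem_differenceDegreeLT_succ.2 fun y =>
      ih fun i => mem_differenceDegreeLT_succ.1 (hf i) y

theorem pos_of_mem_differenceDegreeLT {d : ℕ} {f : S → M} (hf : f ∈ differenceDegreeLT S M d)
    (hf0 : f ≠ 0) : 0 < d :=
  Nat.pos_of_ne_zero fun hd => hf0 (by subst hd; exact hf)

theorem degree_taylor_sub_lt {R : Type*} [CommRing R] (y : R) {d : ℕ} {q : Polynomial R}
    (hq : q.degree < (d + 1 : ℕ)) : (Polynomial.taylor y q - q).degree < d := by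
  rcases eq_or_ne q 0 with rfl | hq0
  · simp
  · have hdeg := Polynomial.degree_taylor q y
    have hlt : (Polynomial.taylor y q - q).degree < q.degree := hdeg ▸
      Polynomial.degree_sub_lt_left hdeg ((Polynomial.taylor_eq_zero y q).not.2 hq0)
        (Polynomial.leadingCoeff_taylor ..)
    have hle : q.degree ≤ d := by
      rw [Polynomial.degree_eq_natDegree hq0] at hq ⊢
      exact_mod_cast Nat.lt_succ_iff.1 (Nat.cast_lt.1 hq)
    exact hlt.trans_le hle

theorem eval_mem_differenceDegreeLT {R : Type*} [CommRing R] {d : ℕ} {q : Polynomial R}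
    (hq : q.degree < d) : (fun x => q.eval x) ∈ differenceDegreeLT R R d := by
  induction d generalizing q with
  | zero =>
    obtain rfl : q = 0 := by simpa using hq
    exact funext fun x => Polynomial.eval_zero
  | succ d ih =>
    refine mem_differenceDegreeLT_succ.2 fun y => ?_
    have hdiff : Δ_[y] (fun x => q.eval x) = fun x => (Polynomial.taylor y q - q).eval x := by
      ext x
      simp [fwdDiff, Polynomial.taylor_eval]
    rw [hdiff]
    exact ih (degree_taylor_sub_lt y hq)

/-- The map `x ↦ q(x + y)`, normalized to vanish at `0`. -/
def increment (y : S) (q : S → M) : S → M := fun x => q (x + y) - q y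

theorem increment_sub_self_mem {d : ℕ} {q : S → M} (hq : q ∈ differenceDegreeLT S M (d + 1))
    (hq0 : q 0 = 0) (y : S) : increment y q - q ∈ differenceDegreeLT S M d := by
  have h : increment y q - q = fun x => Δ_[y] q x - Δ_[y] q 0 := by
    ext x
    simp only [increment, fwdDiff, Pi.sub_apply, zero_add, hq0]
    abel
  rw [h]
  exact sub_const_mem_differenceDegreeLT (mem_differenceDegreeLT_succ.1 hq y) 0

/-- The maps `x ↦ q(x + y) - q(y) - p(x)` with `q ∈ A` and `y ∈ Y`. Recurrence of this family along
a step `x` controls `A` at all the steps `x + y`, and PET induction takes for `p` a map of least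
degree in `A`. -/
def reducedFamily (p : S → M) (Y : Set S) (A : Set (S → M)) : Set (S → M) :=
  Set.image2 (fun y q => increment y q - p) Y A

theorem finite_reducedFamily (p : S → M) {Y : Set S} (hY : Y.Finite) {A : Set (S → M)}
    (hA : A.Finite) : (reducedFamily p Y A).Finite :=
  hY.image2 _ hA

theorem apply_zero_of_mem_reducedFamily {p : S → M} (hp0 : p 0 = 0) {Y : Set S}
    {A : Set (S → M)} : ∀ q ∈ reducedFamily p Y A, q 0 = 0 := by
  rintro _ ⟨y, -, q, -, rfl⟩
  simp [increment, hp0]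

/-- The map `q` has degree at most `c.1`, and the same term of degree `c.1` as `c.2`. The pairs `c`
stand for the equivalence classes of maps by which PET induction measures a family. -/
def HasTopTerm (c : ℕ × (S → M)) (q : S → M) : Prop :=
  q ∈ differenceDegreeLT S M (c.1 + 1) ∧ q - c.2 ∈ differenceDegreeLT S M c.1

theorem HasTopTerm.increment_sub {c : ℕ × (S → M)} {p q : S → M} (hq : HasTopTerm c q)
    (hq0 : q 0 = 0) (hp : p ∈ differenceDegreeLT S M (c.1 + 1)) (y : S) :
    HasTopTerm (c.1, c.2 - p) (increment y q - p) := by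
  have hy := increment_sub_self_mem hq.1 hq0 y
  constructor
  · rw [← sub_add_cancel (increment y q) q]
    exact sub_mem (add_mem (differenceDegreeLT_mono (Nat.le_succ _) hy) hq.1) hp
  · rw [sub_sub_sub_cancel_right, ← sub_add_sub_cancel (increment y q) q c.2]
    exact add_mem hy hq.2

theorem HasTopTerm.increment_sub_mem {c : ℕ × (S → M)} {p q : S → M} (hq : HasTopTerm c q)
    (hq0 : q 0 = 0) (hp : HasTopTerm c p) (y : S) :
    increment y q - p ∈ differenceDegreeLT S M c.1 := by
  have hy : increment y q - q ∈ differenceDegreeLT S M c.1 := increment_sub_self_mem hq.1 hq0 y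
  have hqp : q - p ∈ differenceDegreeLT S M c.1 := by
    rw [← sub_sub_sub_cancel_right q p c.2]
    exact sub_mem hq.2 hp.2
  rw [← sub_add_sub_cancel (increment y q) q p]
  exact add_mem hy hqp

theorem hasTopTerm_self {d : ℕ} {q : S → M} (hq : q ∈ differenceDegreeLT S M (d + 1)) :
    HasTopTerm (d, q) q :=
  ⟨hq, by rw [sub_self]; exact zero_mem _⟩

/-- Every map in `A` belongs to one of the classes in `T`. -/
def HasTopTermsIn (T : Multiset (ℕ × (S → M))) (A : Set (S → M)) : Prop :=
  ∀ q ∈ A, ∃ c ∈ T, HasTopTerm c q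

theorem HasTopTermsIn.exists_minimal {T : Multiset (ℕ × (S → M))} {A : Set (S → M)}
    (hT : HasTopTermsIn T A) (hA : A.Nonempty) :
    ∃ c ∈ T, ∃ p ∈ A, HasTopTerm c p ∧
      ∀ c' ∈ T, ∀ q ∈ A, HasTopTerm c' q → c.1 ≤ c'.1 := by
  obtain ⟨q, hq⟩ := hA
  obtain ⟨c, hcT, hc⟩ := hT q hq
  obtain ⟨c, ⟨hcT, p, hpA, hp⟩, hmin⟩ := exists_minimalFor_of_wellFoundedLT
    (fun c => c ∈ T ∧ ∃ p ∈ A, HasTopTerm c p) Prod.fst ⟨c, hcT, q, hq, hc⟩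
  refine ⟨c, hcT, p, hpA, hp, fun c' hc'T q hqA hq => ?_⟩
  exact (le_total c.1 c'.1).elim id fun h => hmin ⟨hc'T, q, hqA, hq⟩ h

/-- The step of PET induction: the class of `p` is replaced by classes of lower degree, and all
other classes are translated by `-p`. -/
theorem HasTopTermsIn.exists_reducedFamily {T : Multiset (ℕ × (S → M))} {A : Set (S → M)}
    (hT : HasTopTermsIn T A) (hAfin : A.Finite) (hA : A.Nonempty) (hA0 : ∀ q ∈ A, q 0 = 0) :
    ∃ p ∈ A, ∀ Y : Set S, Y.Finite → ∃ T' : Multiset (ℕ × (S → M)),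
      (T'.map Prod.fst).IsDershowitzMannaLT (T.map Prod.fst) ∧
      HasTopTermsIn T' (reducedFamily p Y A \ {0}) := by
  obtain ⟨c, hcT, p, hpA, hp, hmin⟩ := hT.exists_minimal hA
  obtain ⟨T₀, rfl⟩ := Multiset.exists_cons_of_mem hcT
  refine ⟨p, hpA, fun Y hY => ?_⟩
  have hA' := finite_reducedFamily p hY hAfin
  let translated := T₀.map fun c' => (c'.1, c'.2 - p)
  let lower := (Finset.range c.1 ×ˢ hA'.toFinset).val
  have mem_lower {c'} : c' ∈ lower ↔ c'.1 < c.1 ∧ c'.2 ∈ reducedFamily p Y A := by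
    simp only [lower, Finset.mem_val, Finset.mem_product, Finset.mem_range, hA'.mem_toFinset]
  refine ⟨translated + lower,
    ⟨T₀.map Prod.fst, lower.map Prod.fst, {c.1}, by simp, ?_, ?_, ?_⟩, ?_⟩
  · simp [translated]
  · rw [Multiset.map_cons, add_comm, Multiset.singleton_add]
  · exact Multiset.forall_mem_map_iff.2 fun c' hc' =>
      ⟨c.1, Multiset.mem_singleton_self _, (mem_lower.1 hc').1⟩
  · rintro _ ⟨⟨y, hy, q, hq, rfl⟩, hne⟩
    obtain ⟨c', hc'T, hqc'⟩ := hT q hq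
    rcases Multiset.mem_cons.1 hc'T with rfl | hc'T₀
    · have hdeg := hqc'.increment_sub_mem (hA0 q hq) hp y
      have hpos : 0 < c'.1 := pos_of_mem_differenceDegreeLT hdeg hne
      rw [← Nat.sub_add_cancel hpos] at hdeg
      have hlower : (c'.1 - 1, increment y q - p) ∈ lower :=
        mem_lower.2 ⟨Nat.sub_lt hpos one_pos, y, hy, q, hq, rfl⟩
      exact ⟨_, Multiset.mem_add.2 (Or.inr hlower), hasTopTerm_self hdeg⟩
    · have hpdeg := differenceDegreeLT_mono (Nat.succ_le_succ (hmin c' hc'T q hq hqc')) hp.1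
      exact ⟨_, Multiset.mem_add.2 (Or.inl (Multiset.mem_map_of_mem _ hc'T₀)),
        hqc'.increment_sub (hA0 q hq) hpdeg y⟩

end DifferenceDegree

section PolynomialVanDerWaerden

variable {S M κ : Type*} [AddCommGroup M]

/-- A family `A` of maps is partition recurrent if every coloring of `M` by `k` colors is constant
on some `{h} ∪ {h + q(x) : q ∈ A}` with `x` outside a prescribed finite set `B`. By compactness
`h` and `x` can be taken from finite sets that do not depend on the coloring; the definition
asks for this because the induction colors points by the patterns around them. -/
def IsPartitionRecurrent (A : Set (S → M)) : Prop :=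
  ∀ B : Set S, B.Finite → ∀ k : ℕ, ∃ H : Set M, H.Finite ∧ ∃ D : Set S, D.Finite ∧ Disjoint D B ∧
    ∀ χ : M → Fin k, ∃ h ∈ H, ∃ x ∈ D, ∀ q ∈ A, χ (h + q x) = χ h

theorem IsPartitionRecurrent.exists_of_finite {A : Set (S → M)} (hA : IsPartitionRecurrent A)
    {B : Set S} (hB : B.Finite) (κ : Type*) [Finite κ] :
    ∃ H : Set M, H.Finite ∧ ∃ D : Set S, D.Finite ∧ Disjoint D B ∧
      ∀ χ : M → κ, ∃ h ∈ H, ∃ x ∈ D, ∀ q ∈ A, χ (h + q x) = χ h := by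
  obtain ⟨k, ⟨e⟩⟩ := Finite.exists_equiv_fin κ
  obtain ⟨H, hH, D, hD, hDB, hχ⟩ := hA B hB k
  refine ⟨H, hH, D, hD, hDB, fun χ => ?_⟩
  obtain ⟨h, hh, x, hx, hq⟩ := hχ (e ∘ χ)
  exact ⟨h, hh, x, hx, fun q hqA => e.injective (hq q hqA)⟩

theorem IsPartitionRecurrent.of_sdiff_zero {A : Set (S → M)}
    (hA : IsPartitionRecurrent (A \ {0})) : IsPartitionRecurrent A := by
  intro B hB k
  obtain ⟨H, hH, D, hD, hDB, hχ⟩ := hA B hB k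
  refine ⟨H, hH, D, hD, hDB, fun χ => ?_⟩
  obtain ⟨h, hh, x, hx, hmono⟩ := hχ χ
  refine ⟨h, hh, x, hx, fun q hq => ?_⟩
  by_cases hq0 : q = 0
  · rw [hq0, Pi.zero_apply, add_zero]
  · exact hmono q ⟨hq, hq0⟩

theorem isPartitionRecurrent_empty [Infinite S] :
    IsPartitionRecurrent (∅ : Set (S → M)) := by
  intro B hB k
  obtain ⟨x, hx⟩ := hB.exists_notMem
  exact ⟨{0}, Set.finite_singleton 0, {x}, Set.finite_singleton x,
    Set.disjoint_singleton_left.2 hx, fun χ => ⟨0, rfl, x, rfl, by simp⟩⟩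

/-- For every entry `b` of the list and every later entry `a` there is a step `d ∈ D` such that all
the points `b + q(d)` with `q ∈ A` have the color of `a`. -/
def IsFocusingChain (χ : M → κ) (A : Set (S → M)) (D : Set S) (l : List M) : Prop :=
  l.Pairwise fun b a => ∃ d ∈ D, ∀ q ∈ A, χ (b + q d) = χ a

theorem IsFocusingChain.exists_eq [Fintype κ] {χ : M → κ} {A : Set (S → M)} {D : Set S}
    {l : List M} (hl : IsFocusingChain χ A D l) (hcard : Fintype.card κ < l.length) :
    ∃ h ∈ l, ∃ d ∈ D, ∀ q ∈ A, χ (h + q d) = χ h := by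
  by_contra! hno
  have hnodup : (l.map χ).Nodup := by
    refine List.pairwise_map.2 (hl.imp_of_mem ?_)
    rintro b a hb - ⟨d, hd, hba⟩ heq
    obtain ⟨q, hq, hne⟩ := hno b hb d hd
    exact hne ((hba q hq).trans heq.symm)
  exact hcard.not_ge (l.length_map χ ▸ hnodup.length_le_card)

variable [AddCommGroup S]

/-- Recurrence of the reduced family moves a focusing chain to one whose new first point
`h + b - p(x)` focuses, along the steps `x + y`, on all points of the old chain. -/
theorem IsFocusingChain.cons_shift {χ : M → κ} {A : Set (S → M)} {D D' : Set S} {h b : M}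
    {l : List M} (hl : IsFocusingChain (fun m => χ (h + m)) A D (b :: l)) (hA0 : ∀ q ∈ A, q 0 = 0)
    {p : S → M} {x : S} (hx : x ∈ D')
    (hshift : ∀ y ∈ insert 0 D, ∀ q ∈ A, χ (h + b - p x + q (x + y)) = χ (h + (b + q y))) :
    IsFocusingChain χ A (D ∪ (D' + insert 0 D)) ((h + b - p x) :: (b :: l).map (h + ·)) := by
  have hstep : ∀ y ∈ insert 0 D, x + y ∈ D ∪ (D' + insert 0 D) := fun y hy =>
    Or.inr (Set.add_mem_add hx hy)
  refine List.pairwise_cons.2 ⟨List.forall_mem_map.2 fun a ha => ?_, List.pairwise_map.2 ?_⟩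
  · rcases List.mem_cons.1 ha with rfl | ha
    · refine ⟨x + 0, hstep 0 (Set.mem_insert _ _), fun q hq => ?_⟩
      rw [hshift 0 (Set.mem_insert _ _) q hq, hA0 q hq, add_zero]
    · obtain ⟨d, hd, hba⟩ := List.rel_of_pairwise_cons hl ha
      have hd' := Set.mem_insert_of_mem 0 hd
      exact ⟨x + d, hstep d hd', fun q hq => (hshift d hd' q hq).trans (hba q hq)⟩
  · refine hl.imp fun ⟨d, hd, hba⟩ => ⟨d, Or.inl hd, fun q hq => ?_⟩
    rw [add_assoc]
    exact hba q hq

theorem exists_shift_of_reducedFamily {A : Set (S → M)} (hA : A.Finite) {p : S → M} {E : Set S}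
    (hE : E.Finite) (hrec : IsPartitionRecurrent (reducedFamily p E A))
    {H : Set M} (hH : H.Finite) {B : Set S} (hB : B.Finite) (k : ℕ) :
    ∃ H' : Set M, H'.Finite ∧ ∃ D' : Set S, D'.Finite ∧ Disjoint D' B ∧
      ∀ χ : M → Fin k, ∃ h ∈ H', ∃ x ∈ D', ∀ b ∈ H, ∀ y ∈ E, ∀ q ∈ A,
        χ (h + b - p x + q (x + y)) = χ (h + (b + q y)) := by
  have : Finite H := hH
  have : Finite E := hE
  have : Finite A := hA
  obtain ⟨H', hH', D', hD', hDB', hχ⟩ := hrec.exists_of_finite hB (H → E → A → Fin k)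
  refine ⟨H', hH', D', hD', hDB', fun χ => ?_⟩
  obtain ⟨h, hh, x, hx, hpattern⟩ := hχ fun m b y q => χ (m + (b + q.1 y))
  refine ⟨h, hh, x, hx, fun b hb y hy q hq => ?_⟩
  have heq : χ (h + (q (x + y) - q y - p x) + (b + q y)) = χ (h + (b + q y)) :=
    congrFun (congrFun (congrFun (hpattern _ ⟨y, hy, q, hq, rfl⟩) ⟨b, hb⟩) ⟨y, hy⟩) ⟨q, hq⟩
  rw [← heq]
  congr 1
  abel

theorem exists_isFocusingChain {A : Set (S → M)} (hA : A.Finite) (hA0 : ∀ q ∈ A, q 0 = 0)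
    {p : S → M} (hrec : ∀ Y : Set S, Y.Finite → IsPartitionRecurrent (reducedFamily p Y A))
    {B : Set S} (hB : B.Finite) (k s : ℕ) :
    ∃ H : Set M, H.Finite ∧ ∃ D : Set S, D.Finite ∧ Disjoint D B ∧
      ∀ χ : M → Fin k, ∃ b l, l.length = s ∧ (∀ m ∈ b :: l, m ∈ H) ∧
        IsFocusingChain χ A D (b :: l) := by
  induction s with
  | zero =>
    exact ⟨{0}, Set.finite_singleton 0, ∅, Set.finite_empty, Set.empty_disjoint B,
      fun χ => ⟨0, [], rfl, by simp, List.pairwise_singleton _ _⟩⟩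
  | succ s ih =>
    obtain ⟨H, hH, D, hD, hDB, hchain⟩ := ih
    have hE : (insert 0 D).Finite := hD.insert 0
    obtain ⟨H', hH', D', hD', hDB', hshift⟩ :=
      exists_shift_of_reducedFamily hA hE (hrec _ hE) hH (hB.sub hE) k
    have hHH : (H' + H).Finite := hH'.add hH
    refine ⟨(H' + H) ∪ (H' + H - p '' D'), hHH.union (hHH.sub (hD'.image p)),
      D ∪ (D' + insert 0 D), hD.union (hD'.add hE), ?_, fun χ => ?_⟩
    · refine Set.disjoint_union_left.2 ⟨hDB, Set.disjoint_left.2 ?_⟩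
      rintro _ ⟨x, hx, y, hy, rfl⟩ hxyB
      exact Set.disjoint_left.1 hDB' hx ⟨x + y, hxyB, y, hy, add_sub_cancel_right x y⟩
    · obtain ⟨h, hh, x, hx, hpattern⟩ := hshift χ
      obtain ⟨b, l, hlen, hlH, hl⟩ := hchain fun m => χ (h + m)
      have hlH' : ∀ m ∈ b :: l, h + m ∈ H' + H := fun m hm => Set.add_mem_add hh (hlH m hm)
      refine ⟨h + b - p x, (b :: l).map (h + ·), by simp [hlen], ?_,
        hl.cons_shift hA0 hx (hpattern b (hlH b List.mem_cons_self))⟩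
      refine List.forall_mem_cons.2 ⟨Or.inr ?_, List.forall_mem_map.2 fun m hm => Or.inl ?_⟩
      · exact Set.sub_mem_sub (hlH' b List.mem_cons_self) (Set.mem_image_of_mem p hx)
      · exact hlH' m hm

theorem IsPartitionRecurrent.of_reducedFamily {A : Set (S → M)} (hA : A.Finite)
    (hA0 : ∀ q ∈ A, q 0 = 0) {p : S → M}
    (hrec : ∀ Y : Set S, Y.Finite → IsPartitionRecurrent (reducedFamily p Y A)) :
    IsPartitionRecurrent A := by
  intro B hB k
  obtain ⟨H, hH, D, hD, hDB, hchain⟩ := exists_isFocusingChain hA hA0 hrec hB k k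
  refine ⟨H, hH, D, hD, hDB, fun χ => ?_⟩
  obtain ⟨b, l, hlen, hlH, hl⟩ := hchain χ
  obtain ⟨h, hh, hmono⟩ := hl.exists_eq (by simp [hlen])
  exact ⟨h, hlH h hh, hmono⟩

theorem HasTopTermsIn.isPartitionRecurrent [Infinite S] {T : Multiset (ℕ × (S → M))}
    {A : Set (S → M)} (hT : HasTopTermsIn T A) (hA : A.Finite) (hA0 : ∀ q ∈ A, q 0 = 0) :
    IsPartitionRecurrent A := by
  induction T using
    (InvImage.wf (Multiset.map Prod.fst)
      (Multiset.wellFounded_isDershowitzMannaLT (α := ℕ))).induction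
    generalizing A with
  | _ T ih =>
  rcases A.eq_empty_or_nonempty with rfl | hAne
  · exact isPartitionRecurrent_empty
  obtain ⟨p, hpA, hp⟩ := hT.exists_reducedFamily hA hAne hA0
  refine .of_reducedFamily hA hA0 (p := p) fun Y hY => .of_sdiff_zero ?_
  obtain ⟨T', hlt, hT'⟩ := hp Y hY
  exact ih T' hlt hT' (finite_reducedFamily p hY hA).sdiff fun q hq =>
    apply_zero_of_mem_reducedFamily (hA0 p hpA) q hq.1

theorem isPartitionRecurrent_of_mem_differenceDegreeLT [Infinite S] {A : Set (S → M)}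
    (hA : A.Finite) (hA0 : ∀ q ∈ A, q 0 = 0) (hAdeg : ∀ q ∈ A, ∃ d, q ∈ differenceDegreeLT S M d) :
    IsPartitionRecurrent A := by
  choose! deg hdeg using hAdeg
  have hT : HasTopTermsIn (hA.toFinset.val.map fun q => (deg q, q)) A := fun q hq =>
    ⟨(deg q, q), Multiset.mem_map_of_mem _ (hA.mem_toFinset.2 hq),
      hasTopTerm_self (differenceDegreeLT_mono (Nat.le_succ _) (hdeg q hq))⟩
  exact hT.isPartitionRecurrent hA hA0

end PolynomialVanDerWaerden

section PolynomialMapping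

open MvPolynomial

variable {R σ : Type*} [CommRing R]

/-- The restriction of a multivariate polynomial to the line through `0` and `v`. -/
noncomputable def lineRestriction (v : σ → R) (p : MvPolynomial σ R) : Polynomial R :=
  aeval (fun j => Polynomial.C (v j) * Polynomial.X) p

theorem eval_lineRestriction (v : σ → R) (p : MvPolynomial σ R) (x : R) :
    (lineRestriction v p).eval x = eval (x • v) p := by
  rw [lineRestriction, ← Polynomial.coe_evalRingHom, map_aeval]
  refine eval₂Hom_congr ?_ ?_ rfl
  · ext r
    exact Polynomial.eval_C
  · ext j
    simpa using mul_comm (v j) x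

theorem exists_eval_smul_mem_differenceDegreeLT {ι : Type*} [Finite ι]
    (p : ι → MvPolynomial σ R) (v : σ → R) :
    ∃ d, (fun (x : R) i => eval (x • v) (p i)) ∈ differenceDegreeLT R (ι → R) d := by
  obtain ⟨d, hd⟩ := Finite.exists_le fun i => (lineRestriction v (p i)).natDegree
  refine ⟨d + 1, mem_differenceDegreeLT_pi fun i => ?_⟩
  simp only [← eval_lineRestriction]
  exact eval_mem_differenceDegreeLT
    (Polynomial.degree_le_natDegree.trans_lt (Nat.cast_lt.2 (Nat.lt_succ_of_le (hd i))))

theorem finite_setOf_eval_smul_eq [IsDomain R] {p : MvPolynomial σ R} {v w : σ → R}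
    (h : eval v p ≠ eval w p) : {x : R | eval (x • v) p = eval (x • w) p}.Finite := by
  have hne : lineRestriction v p - lineRestriction w p ≠ 0 := fun h0 => h <| by
    simpa [eval_lineRestriction, sub_eq_zero] using congrArg (Polynomial.eval 1) h0
  refine (Polynomial.finite_setOfPred_isRoot hne).subset fun x hx => ?_
  simpa [eval_lineRestriction, sub_eq_zero] using hx

theorem finite_setOf_not_injOn_smul [IsDomain R] {ι : Type*} {P : (σ → R) → ι → R}
    {p : ι → MvPolynomial σ R} (hP : ∀ v i, P v i = eval v (p i)) {F : Set (σ → R)} (hF : F.Finite)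
    (hinj : Set.InjOn P F) : {x : R | ¬ Set.InjOn (fun v => P (x • v)) F}.Finite := by
  have hpair : ∀ v ∈ F, ∀ w ∈ F, {x : R | v ≠ w ∧ P (x • v) = P (x • w)}.Finite := by
    intro v hv w hw
    rcases eq_or_ne v w with rfl | hvw
    · simp
    obtain ⟨i, hi⟩ := Function.ne_iff.1 (hinj.ne hv hw hvw)
    rw [hP, hP] at hi
    refine (finite_setOf_eval_smul_eq hi).subset fun x hx => ?_
    change eval (x • v) (p i) = eval (x • w) (p i)
    rw [← hP, ← hP, hx.2]
  refine (hF.biUnion fun v hv => hF.biUnion (hpair v hv)).subset fun x hx => ?_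
  simp only [Set.InjOn, Set.mem_ofPred_eq, not_forall] at hx
  obtain ⟨v, hv, w, hw, heq, hvw⟩ := hx
  exact Set.mem_biUnion hv (Set.mem_biUnion hw ⟨hvw, heq⟩)

theorem corollary7p12_general [IsDomain R] [Infinite R] {ι κ : Type*} [Finite ι] [Finite κ]
    {P : (σ → R) → ι → R} (hP : ∃ p : ι → MvPolynomial σ R, ∀ v i, P v i = eval v (p i))
    {F : Set (σ → R)} (hF : F.Finite) (hinj : Set.InjOn P F) (χ : (ι → R) → κ) :
    ∃ (h : ι → R) (x : R), (∃ c, ∀ v ∈ F, χ (h + P (x • v)) = c) ∧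
      Set.InjOn (fun v => h + P (x • v)) F := by
  obtain ⟨p, hp⟩ := hP
  let displacements : Set (R → ι → R) := (fun v x => P (x • v) - P 0) '' F
  have hrec : IsPartitionRecurrent displacements := by
    refine isPartitionRecurrent_of_mem_differenceDegreeLT (hF.image _) ?_ ?_
    · rintro _ ⟨v, -, rfl⟩
      simp
    · rintro _ ⟨v, -, rfl⟩
      obtain ⟨d, hd⟩ := exists_eval_smul_mem_differenceDegreeLT p v
      refine ⟨d, ?_⟩
      simpa only [← hp, zero_smul] using sub_const_mem_differenceDegreeLT hd 0
  obtain ⟨H, -, D, -, hD, hχ⟩ :=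
    hrec.exists_of_finite (finite_setOf_not_injOn_smul hp hF hinj) κ
  obtain ⟨h, -, x, hx, hmono⟩ := hχ χ
  have hinjx : Set.InjOn (fun v => P (x • v)) F := not_not.1 (Set.disjoint_left.1 hD hx)
  refine ⟨h - P 0, x, ⟨χ h, fun v hv => ?_⟩, fun v hv w hw hvw => ?_⟩
  · rw [sub_add_eq_add_sub, add_sub_assoc]
    exact hmono _ ⟨v, hv, rfl⟩
  · exact hinjx hv hw (add_left_cancel hvw)

end PolynomialMapping

theorem corollary7p12 {G : Type*} [CommRing G] [IsDomain G] [Infinite G] (n t : ℕ)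
    (P : (Fin n → G) → (Fin t → G)) (hP : IsPolynomialMapping P) (hP0 : P 0 = 0)
    (F : Finset (Fin n → G)) (hF : Set.InjOn P (F : Set (Fin n → G)))
    (r : ℕ) (χ : (Fin t → G) → Fin r) :
    ∃ (h : Fin t → G) (x : G),
      IsMonochromatic χ ((fun v => h + P (x • v)) '' (F : Set (Fin n → G))) ∧
      ((fun v => h + P (x • v)) '' (F : Set (Fin n → G))).ncard = F.card := by
  obtain ⟨h, x, ⟨c, hc⟩, hinj⟩ := corollary7p12_general hP F.finite_toSet hF χ
  exact ⟨h, x, ⟨c, Set.forall_mem_image.2 hc⟩, hinj.ncard_image.trans (Set.ncard_coe_finset F)⟩
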